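/- Let $S$ be a partially ordered Polish space, that is, a separable, completely metrizable topological space with Borel $\sigma$-algebra $\mathscr B$, equipped with a partial order $\leq$ that is closed in $S\times S$. Assume that a subset of $S$ is compact if and only if it is closed and order bounded (contained in $[a,b]=\{x: a\le x\le b\}$ for some $a\le b$ in $S$). Let $\mathscr P(S)$ be the set of Borel probability measures on $S$ and let $ibS$ be the set of bounded measurable functions $h\colon S\to\mathbb R$ with $h(x)\le h(y)$ whenever $x\le y$. Equip $\mathscr P(S)$ with the Bhattacharya metric $$\beta(\phi,\psi)=\sup\Big\{\Big|\int h\,d\phi-\int h\,d\psi\Big| : h\in ibS,\ |h|\le 1\Big\}.$$ Let $P$ be a stochastic (Markov) kernel on $S$, acting on $\mathscr P(S)$ by $(\phi P)(B)=\int P(x,B)\,\phi(dx)$, and let $P^t$ be its $t$-step kernel, $P^0(x,\cdot)=\delta_x$. Assume that: * $P$ is increasing: $\int h(y)\,P(x,dy)\le\int h(y)\,P(x',dy)$ for all $h\in ibS$ and all $x\le x'$ in $S$; * $P$ is order reversing: there are $S$-valued processes $(X_t)_{t\in\mathbb Z_+}$ and $(X'_t)_{t\in\mathbb Z_+}$ on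 a common measurable space, with probability laws $\mathbb P_{x,x'}$ ($x,x'\in S$), such that under each $\mathbb P_{x,x'}$ the two processes are independent, $X_0=x$ and $X_0'=x'$ almost surely, and each is $P$-Markov, i.e. $\mathbb P_{x,x'}\{X_{t+1}\in B\mid X_0,\dots,X_t\}=P(X_t,B)$ almost surely for all $t\in\mathbb Z_+$ and $B\in\mathscr B$ (and likewise for $X'$); and for all $x,x'\in S$ with $x'\le x$ there is a $t\in\mathbb Z_+$ with $\mathbb P_{x,x'}\{X_t\le X'_t\}>0$. Then the following are equivalent: 1. $P$ is globally stable: the map $\phi\mapsto\phi P$ has a unique stationary point $\phi^*\in\mathscr P(S)$ (a distribution with $\phi^*P^t=\phi^*$ for all $t\in\mathbb Z_+$), and $\beta(\phi P^t,\phi^*)\to0$ as $t\to\infty$ for every $\phi\in\mathscr P(S)$; 2. $P$ is bounded in probability: for every $x\in S$ the family $\{P^t(x,\cdot): t\in\mathbb Z_+\}$ is tight, i.e. for every $\epsilon>0$ there is a compact $K\subset S$ with $P^t(x,S\setminus K)\le\epsilon$ for all $t\in\mathbb Z_+$. -/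

import Mathlib

open MeasureTheory ProbabilityTheory Filter Topology

universe u

namespace MonotoneMarkov

/-- A set is order bounded if it is contained in some order interval `[a, b]` with `a ≤ b`. -/
def OrderBounded {S : Type u} [PartialOrder S] (B : Set S) : Prop :=
  ∃ a b : S, a ≤ b ∧ B ⊆ Set.Icc a b

/-- The standing restriction on the state space: a subset is compact if and only if it is closed
and order bounded. -/
def CompactIffClosedOrderBounded (S : Type u) [TopologicalSpace S] [PartialOrder S] : Prop :=
  ∀ K : Set S, IsCompact K ↔ IsClosed K ∧ OrderBounded K

section Distributions

variable {S : Type u} [MeasurableSpace S] [PartialOrder S]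

/-- The class `ibS` of bounded measurable increasing functions `S → ℝ`. -/
def IncBddMeas (S : Type u) [MeasurableSpace S] [PartialOrder S] : Set (S → ℝ) :=
  {h | Measurable h ∧ Monotone h ∧ ∃ C : ℝ, ∀ x, |h x| ≤ C}

/-- First order stochastic dominance `φ ⪯ ψ` between distributions. -/
def StochDom (φ ψ : ProbabilityMeasure S) : Prop :=
  ∀ h ∈ IncBddMeas S, ∫ x, h x ∂(φ : Measure S) ≤ ∫ x, h x ∂(ψ : Measure S)

/-- The Bhattacharya metric
`β(φ, ψ) = sup { |φ(h) - ψ(h)| : h ∈ ibS, |h| ≤ 1 }`.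
The supremum is over a nonempty family of reals bounded by `2`. -/
noncomputable def bhattacharya (φ ψ : ProbabilityMeasure S) : ℝ :=
  ⨆ h : {h : S → ℝ // h ∈ IncBddMeas S ∧ ∀ x, |h x| ≤ 1},
    |∫ x, h.1 x ∂(φ : Measure S) - ∫ x, h.1 x ∂(ψ : Measure S)|

/-- A self-map `T` of the space of distributions is globally stable (with respect to the
Bhattacharya metric) if the semigroup `(T^t)` has a unique stationary point `φstar` and
`β(T^t φ, φstar) → 0` for every distribution `φ`. -/
def GloballyStableMap (T : ProbabilityMeasure S → ProbabilityMeasure S) : Prop :=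
  ∃ φstar : ProbabilityMeasure S,
    (∀ t : ℕ, T^[t] φstar = φstar) ∧
    (∀ ψ : ProbabilityMeasure S, (∀ t : ℕ, T^[t] ψ = ψ) → ψ = φstar) ∧
    ∀ φ : ProbabilityMeasure S,
      Tendsto (fun t : ℕ => bhattacharya (T^[t] φ) φstar) atTop (𝓝 0)

end Distributions

section Kernels

variable {S : Type u} [MeasurableSpace S]

/-- The distribution `P(x, ·)`, as an element of the space of distributions. -/
noncomputable def kernelAt (P : Kernel S S) [IsMarkovKernel P] (x : S) : ProbabilityMeasure S :=
  ⟨P x, inferInstance⟩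

/-- The left Markov operator `φ ↦ φP`, `(φP)(B) = ∫ P(x, B) φ(dx)`. -/
noncomputable def markovOp (P : Kernel S S) [IsMarkovKernel P]
    (φ : ProbabilityMeasure S) : ProbabilityMeasure S :=
  ⟨(φ : Measure S).bind P, inferInstance⟩

/-- The `t`-step kernel `P^t`, with `P^0(x, ·) = δ_x` and
`P^(t+1)(x, B) = ∫ P(y, B) P^t(x, dy)`. -/
noncomputable def stepKernel (P : Kernel S S) : ℕ → Kernel S S
  | 0 => Kernel.id
  | t + 1 => P ∘ₖ stepKernel P t

/-- A stochastic kernel is increasing if `x ≤ x'` implies `P(x, ·) ⪯ P(x', ·)`. -/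
def IncreasingKernel [PartialOrder S] (P : Kernel S S) [IsMarkovKernel P] : Prop :=
  ∀ x x' : S, x ≤ x' → StochDom (kernelAt P x) (kernelAt P x')

/-- A stochastic kernel is globally stable if its Markov operator is. -/
def GloballyStable [PartialOrder S] (P : Kernel S S) [IsMarkovKernel P] : Prop :=
  GloballyStableMap (markovOp P)

/-- `P` is bounded in probability if, for every `x`, the family `(P^t(x, ·))`, `t = 0, 1, 2, …`,
is tight. -/
def BoundedInProbability [TopologicalSpace S] (P : Kernel S S) : Prop :=
  ∀ x : S, IsTightMeasureSet (Set.range fun t : ℕ => stepKernel P t x)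

/-- A process `X` on `(Ω, μ)` is `P`-Markov if
`μ(X_{t+1} ∈ B | ℱ_t) = P(X_t, B)` almost surely for all `t` and all measurable `B`, where `ℱ_t`
is the sigma-algebra generated by `X_0, …, X_t`. -/
def IsMarkovProcess (P : Kernel S S) {Ω : Type u} [MeasurableSpace Ω] (μ : Measure Ω)
    (X : ℕ → Ω → S) : Prop :=
  (∀ t, Measurable (X t)) ∧
  ∀ t : ℕ, ∀ B : Set S, MeasurableSet B →
    μ⟦X (t + 1) ⁻¹' B | ⨆ s : Set.Iic t, MeasurableSpace.comap (X s) inferInstance⟧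
      =ᵐ[μ] fun ω => (P (X t ω)).real B

/-- `P` is order reversing: there are processes `X`, `X'` on a common measurable space `Ω`,
with a family of laws `Pr x x'` on `Ω` indexed by the initial conditions, such that
under `Pr x x'` the processes are independent, `P`-Markov, and start at `x` and `x'`
respectively; and whenever `x' ≤ x` there is a time `t` with
`Pr x x' {X_t ≤ X'_t} > 0`. -/
def OrderReversing [PartialOrder S] (P : Kernel S S) : Prop :=
  ∃ (Ω : Type u) (_ : MeasurableSpace Ω) (X X' : ℕ → Ω → S) (Pr : S → S → Measure Ω),
    (∀ x x' : S,
      IsProbabilityMeasure (Pr x x') ∧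
      IsMarkovProcess P (Pr x x') X ∧
      IsMarkovProcess P (Pr x x') X' ∧
      IndepFun (fun ω t => X t ω) (fun ω t => X' t ω) (Pr x x') ∧
      (∀ᵐ ω ∂(Pr x x'), X 0 ω = x) ∧
      (∀ᵐ ω ∂(Pr x x'), X' 0 ω = x')) ∧
    ∀ x x' : S, x' ≤ x → ∃ t : ℕ, 0 < Pr x x' {ω | X t ω ≤ X' t ω}

end Kernels

end MonotoneMarkov

namespace MonotoneMarkov

open scoped ENNReal

/-! ### Increasing sets in an ordered Polish space: determining class and completeness -/

section OrderedPolish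

variable {S : Type u} [TopologicalSpace S]

/-! Run two independent copies of the chain from `x` and `x'`. Once they are ordered, monotonicity
of `P` keeps expectations of increasing functions ordered, so `P^t f (x) - P^t f (x')` is at most
the probability that the copies have not been ordered up to time `t`, uniformly over increasing `f`
with values in `[0, 1]` (`IncreasingKernel.lintegral_stepKernel_le_survival`).

Suppose `P` is bounded in probability. The pair of chains then spends most times in a box `[a, b] ×
[a, b]` with high probability. From that box the chance of being ordered after `n` steps is smallest
at the corner `(b, a)`, where order reversal makes it positive for some `n`. A contraction argument
then sends the probability of never being ordered to zero (`tendsto_survival_zero`). This gives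
uniqueness and convergence in `β` as soon as a stationary distribution exists. For existence, the
laws `P^t(x, ·)` are uniformly Cauchy on increasing sets (`cauchy_stepKernel`). Tightness gives a
weak cluster point, which is shown to be the limit on every increasing set
(`exists_tendsto_of_tight_of_cauchy`). It is stationary because increasing sets determine a measure
(`ext_of_isClosed_isUpperSet`).

Conversely, under global stability the limit concentrates on a compact order interval. Its
complement is the union of an increasing and a decreasing set, on both of which `β` controls the
mass. -/

theorem isClosed_upperClosure_of_isCompact [Preorder S] [OrderClosedTopology S] {K : Set S}
    (hK : IsCompact K) : IsClosed (upperClosure K : Set S) := by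
  rw [← isOpen_compl_iff, isOpen_iff_mem_nhds]
  intro z hz
  have hopen : IsOpen {p : S × S | p.1 ≤ p.2}ᶜ :=
    OrderClosedTopology.isClosed_le'.isOpen_compl
  have hsub : K ×ˢ {z} ⊆ {p : S × S | p.1 ≤ p.2}ᶜ := by
    rintro ⟨y, w⟩ ⟨hy, hw⟩ hle
    obtain rfl : w = z := hw
    exact hz (mem_upperClosure.2 ⟨y, hy, hle⟩)
  -- Unordered pairs form an open set containing `K × {z}`, so one neighbourhood of `z` serves all
  -- points of `K`.
  obtain ⟨u, v, -, hv, hKu, hzv, huv⟩ :=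
    generalized_tube_lemma hK isCompact_singleton hopen hsub
  refine mem_of_superset (hv.mem_nhds (hzv rfl)) fun w hw hwK => ?_
  obtain ⟨y, hy, hle⟩ := mem_upperClosure.1 hwK
  exact huv (Set.mk_mem_prod (hKu hy) hw) hle

variable [PolishSpace S] [MeasurableSpace S] [BorelSpace S]

/-- Finite measures agreeing on closed increasing sets are equal. -/
theorem ext_of_isClosed_isUpperSet [PartialOrder S] [OrderClosedTopology S]
    {μ ν : Measure S} [IsFiniteMeasure μ] [IsFiniteMeasure ν]
    (h : ∀ F : Set S, IsClosed F → IsUpperSet F → μ F = ν F) : μ = ν := by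
  -- Tightness of the sum gives one σ-compact set `S₀` carrying both measures.
  have htight : IsTightMeasureSet {μ + ν} :=
    isTightMeasureSet_singleton
  rw [isTightMeasureSet_iff_exists_isCompact_measure_compl_le] at htight
  have hK : ∀ n : ℕ, ∃ K : Set S, IsCompact K ∧ (μ + ν) Kᶜ ≤ ((n : ℝ≥0∞) + 1)⁻¹ := by
    intro n
    obtain ⟨K, hK, hle⟩ := htight ((n : ℝ≥0∞) + 1)⁻¹ (by simp)
    exact ⟨K, hK, hle _ rfl⟩
  choose K hKc hKm using hK
  have hnull : (μ + ν) (⋃ n, K n)ᶜ = 0 := by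
    have hlim : Tendsto (fun n : ℕ => ((n : ℝ≥0∞) + 1)⁻¹) atTop (𝓝 0) := by
      have := (ENNReal.tendsto_inv_nat_nhds_zero).comp (tendsto_add_atTop_nat 1)
      simpa [Function.comp_def] using this
    refine le_antisymm (ge_of_tendsto' hlim fun n => (measure_mono ?_).trans (hKm n)) zero_le
    exact Set.compl_subset_compl.2 (Set.subset_iUnion K n)
  set S₀ : Set S := ⋃ n, K n
  have hS₀m : MeasurableSet S₀ := MeasurableSet.iUnion fun n => (hKc n).isClosed.measurableSet
  have hμ0 : μ S₀ᶜ = 0 := by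
    have : μ S₀ᶜ + ν S₀ᶜ = 0 := by simpa using hnull
    exact (add_eq_zero.1 this).1
  have hν0 : ν S₀ᶜ = 0 := by
    have : μ S₀ᶜ + ν S₀ᶜ = 0 := by simpa using hnull
    exact (add_eq_zero.1 this).2
  set b := TopologicalSpace.countableBasis S
  have : Countable b := (TopologicalSpace.countable_countableBasis S).to_subtype
  -- Countably many closed increasing sets that separate the points of `S₀`. Cutting by the compact
  -- `K n` makes the upper closures closed.
  set A : ℕ × b → Set S := fun p => upperClosure (K p.1 ∩ closure (p.2 : Set S))
  have hAc : ∀ p, IsClosed (A p) := fun p =>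
    isClosed_upperClosure_of_isCompact ((hKc p.1).inter_right isClosed_closure)
  have hAu : ∀ p, IsUpperSet (A p) := fun p => UpperSet.upper _
  have hsep : ∀ x ∈ S₀, ∀ y, ¬ x ≤ y → ∃ p, x ∈ A p ∧ y ∉ A p := by
    intro x hx y hxy
    have hU : (Set.Iic y)ᶜ ∈ 𝓝 x := isClosed_Iic.isOpen_compl.mem_nhds hxy
    obtain ⟨t, ⟨htn, htc⟩, htU⟩ := (closed_nhds_basis x).mem_iff.1 hU
    obtain ⟨v, hv, hxv, hvt⟩ :=
      (TopologicalSpace.isBasis_countableBasis S).mem_nhds_iff.1 htn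
    obtain ⟨n, hn⟩ := Set.mem_iUnion.1 hx
    refine ⟨(n, ⟨v, hv⟩), subset_upperClosure ⟨hn, subset_closure hxv⟩, fun hy => ?_⟩
    obtain ⟨z, ⟨-, hz⟩, hzy⟩ := mem_upperClosure.1 hy
    exact htU (closure_minimal hvt htc hz) hzy
  set C : Set (Set S) := {F | IsClosed F ∧ IsUpperSet F}
  have hmle : MeasurableSpace.generateFrom C ≤ ‹MeasurableSpace S› :=
    MeasurableSpace.generateFrom_le fun F hF => hF.1.measurableSet
  have hCpi : IsPiSystem C := fun F hF G hG _ => ⟨hF.1.inter hG.1, hF.2.inter hG.2⟩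
  set f : S → (ℕ × b → Prop) := fun x p => x ∈ A p
  have hfm : Measurable[MeasurableSpace.generateFrom C] f := by
    refine @measurable_pi_lambda _ _ _ (MeasurableSpace.generateFrom C) _ _ fun p => ?_
    exact (@measurableSet_setOfPred _ (MeasurableSpace.generateFrom C) _).1
      (MeasurableSpace.measurableSet_generateFrom ⟨hAc p, hAu p⟩)
  have hfi : Set.InjOn f S₀ := by
    intro x hx y hy hxy
    have key : ∀ p, x ∈ A p ↔ y ∈ A p := fun p => iff_of_eq (congrFun hxy p)
    refine le_antisymm ?_ ?_ <;> by_contra hlt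
    · obtain ⟨p, hp, hp'⟩ := hsep x hx y hlt
      exact hp' ((key p).1 hp)
    · obtain ⟨p, hp, hp'⟩ := hsep y hy x hlt
      exact hp' ((key p).2 hp)
  refine Measure.ext fun E hE => ?_
  -- Lusin–Souslin: the image of a Borel set under an injective Borel map is Borel. Hence `E` agrees
  -- on `S₀` with a set of the σ-algebra generated by closed increasing sets.
  have himg : MeasurableSet (f '' (E ∩ S₀)) :=
    (hE.inter hS₀m).image_of_measurable_injOn (hfm.mono hmle le_rfl)
      (hfi.mono Set.inter_subset_right)
  have heq : f ⁻¹' (f '' (E ∩ S₀)) ∩ S₀ = E ∩ S₀ := by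
    ext x
    constructor
    · rintro ⟨⟨y, hy, hxy⟩, hx⟩
      rwa [← hfi hy.2 hx hxy]
    · intro hx
      exact ⟨⟨x, hx, rfl⟩, hx.2⟩
  have hD := ext_on_measurableSpace_of_generate_finite _ C (μ := μ) (ν := ν)
    (fun F hF => h F hF.1 hF.2) hmle rfl hCpi (h _ isClosed_univ isUpperSet_univ) (hfm himg)
  rw [← measure_inter_conull hμ0, ← measure_inter_conull hν0, heq] at hD
  rwa [measure_inter_conull hμ0, measure_inter_conull hν0] at hD

/-- Along a tight sequence which is uniformly Cauchy on increasing sets, any weak cluster point is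
dominated on increasing sets by the tail of the sequence. -/
theorem eventually_measure_le_of_tendsto_ultrafilter [Preorder S] [OrderClosedTopology S]
    {μ : ℕ → ProbabilityMeasure S} {ν : ProbabilityMeasure S}
    (htight : IsTightMeasureSet (Set.range fun t => (μ t : Measure S)))
    (hcauchy : ∀ ε : ℝ≥0∞, 0 < ε → ∃ T, ∀ t ≥ T, ∀ I : Set S, MeasurableSet I → IsUpperSet I →
      (μ t : Measure S) I ≤ (μ T : Measure S) I + ε ∧
      (μ T : Measure S) I ≤ (μ t : Measure S) I + ε)
    {L : Ultrafilter ℕ} (hL : (L : Filter ℕ) ≤ atTop) (hν : Tendsto μ L (𝓝 ν))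
    {I : Set S} (hI : MeasurableSet I) (hIu : IsUpperSet I) {ε : ℝ≥0∞} (hε : 0 < ε) :
    ∀ᶠ t in atTop, (ν : Measure S) I ≤ (μ t : Measure S) I + 6 * ε := by
  let := TopologicalSpace.upgradeIsCompletelyMetrizable S
  obtain ⟨K, hKI, hK, hIK⟩ := hI.exists_isCompact_lt_add (μ := (ν : Measure S))
    (measure_ne_top _ _) hε.ne'
  obtain ⟨C₀, hC₀, hμC₀⟩ :=
    isTightMeasureSet_iff_exists_isCompact_measure_compl_le.1 htight ε hε
  obtain ⟨T, hT⟩ := hcauchy ε hε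
  set C := C₀ ∪ K
  have hC : IsCompact C := hC₀.union hK
  have hμC : ∀ t, (μ t : Measure S) Cᶜ ≤ ε := fun t =>
    (measure_mono (Set.compl_subset_compl.2 Set.subset_union_left)).trans
      (hμC₀ _ (Set.mem_range_self t))
  set δ : ℕ → ℝ := fun n => 1 / ((n : ℝ) + 1)
  have hδpos : ∀ n, 0 < δ n := fun n => Nat.one_div_pos_of_nat
  have hδanti : Antitone δ := fun a b hab => Nat.one_div_le_one_div hab
  set F : ℕ → Set S := fun n => C ∩ Metric.cthickening (δ n) K
  have hFc : ∀ n, IsCompact (F n) := fun n => hC.inter_right Metric.isClosed_cthickening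
  have hFanti : Antitone F := fun a b hab =>
    Set.inter_subset_inter_right _ (Metric.cthickening_mono (hδanti hab) K)
  -- Closed increasing sets that contain the thickenings of `K` up to `Cᶜ` and shrink, by
  -- compactness of `C`, to a subset of `I`. They link weak convergence, which sees open sets, to
  -- the Cauchy property, which sees increasing sets.
  set G : ℕ → Set S := fun n => upperClosure (F n)
  have hGc : ∀ n, IsClosed (G n) := fun n => isClosed_upperClosure_of_isCompact (hFc n)
  have hGanti : Antitone G := fun a b hab =>
    upperClosure_anti (hFanti hab)
  have hGI : ⋂ n, G n ⊆ I := by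
    intro z hz
    have hne : (⋂ n, F n ∩ Set.Iic z).Nonempty := by
      refine IsCompact.nonempty_iInter_of_sequence_nonempty_isCompact_isClosed _ ?_ ?_ ?_ ?_
      · exact fun n => Set.inter_subset_inter_left _ (hFanti n.le_succ)
      · intro n
        obtain ⟨y, hy, hyz⟩ := mem_upperClosure.1 (Set.mem_iInter.1 hz n)
        exact ⟨y, hy, hyz⟩
      · exact (hFc 0).inter_right isClosed_Iic
      · exact fun n => (hFc n).isClosed.inter isClosed_Iic
    obtain ⟨y, hy⟩ := hne
    have hyK : y ∈ K := by
      have hlim : Tendsto δ atTop (𝓝 0) := tendsto_one_div_add_atTop_nhds_zero_nat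
      rw [← hK.isClosed.closure_eq, ← Metric.cthickening_zero,
        Metric.cthickening_eq_iInter_cthickening]
      refine Set.mem_iInter₂.2 fun r hr => ?_
      obtain ⟨n, hn⟩ := (hlim.eventually_lt_const hr).exists
      exact Metric.cthickening_mono hn.le K (Set.mem_iInter.1 hy n).1.2
    exact hIu (Set.mem_iInter.1 hy 0).2 (hKI hyK)
  have hGlim : Tendsto (fun n => (μ T : Measure S) (G n)) atTop
      (𝓝 ((μ T : Measure S) (⋂ n, G n))) :=
    tendsto_measure_iInter_atTop (fun n => (hGc n).measurableSet.nullMeasurableSet) hGanti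
      ⟨0, measure_ne_top _ _⟩
  obtain ⟨n, hn⟩ := (hGlim.eventually_lt_const
    (ENNReal.lt_add_right (measure_ne_top _ _) hε.ne')).exists
  set U := Metric.thickening (δ n) K
  have hUG : ∀ t, (μ t : Measure S) U ≤ (μ t : Measure S) (G n) + ε := by
    intro t
    have hsub : U ⊆ G n ∪ Cᶜ := by
      intro y hy
      by_cases hyC : y ∈ C
      · exact Or.inl (subset_upperClosure ⟨hyC, Metric.thickening_subset_cthickening _ _ hy⟩)
      · exact Or.inr hyC
    exact (measure_mono hsub).trans ((measure_union_le _ _).trans (by gcongr; exact hμC t))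
  have hport : (ν : Measure S) U ≤ (L : Filter ℕ).liminf fun t => (μ t : Measure S) U :=
    ProbabilityMeasure.le_liminf_measure_open_of_tendsto hν Metric.isOpen_thickening
  have hbound : (L : Filter ℕ).liminf (fun t => (μ t : Measure S) U) ≤
      (μ T : Measure S) I + 3 * ε := by
    refine liminf_le_of_frequently_le' (Eventually.frequently ?_)
    filter_upwards [hL (eventually_ge_atTop T)] with t ht
    calc (μ t : Measure S) U ≤ (μ t : Measure S) (G n) + ε := hUG t
      _ ≤ ((μ T : Measure S) (G n) + ε) + ε := by
        gcongr; exact (hT t ht _ (hGc n).measurableSet (UpperSet.upper _)).1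
      _ ≤ (((μ T : Measure S) I + ε) + ε) + ε := by
        gcongr; exact hn.le.trans (by gcongr)
      _ = (μ T : Measure S) I + 3 * ε := by ring
  filter_upwards [eventually_ge_atTop T] with t ht
  calc (ν : Measure S) I ≤ (ν : Measure S) K + ε := hIK.le
    _ ≤ (ν : Measure S) U + ε := by
      gcongr; exact Metric.self_subset_thickening (hδpos n) K
    _ ≤ ((μ T : Measure S) I + 3 * ε) + ε := by gcongr; exact hport.trans hbound
    _ ≤ (((μ t : Measure S) I + ε) + 3 * ε) + ε := by gcongr; exact (hT t ht I hI hIu).2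
    _ = (μ t : Measure S) I + 5 * ε := by ring
    _ ≤ (μ t : Measure S) I + 6 * ε := by gcongr; norm_num

/-- A tight sequence of probability measures which is uniformly Cauchy on increasing measurable
sets converges on every increasing measurable set to a probability measure. -/
theorem exists_tendsto_of_tight_of_cauchy [PartialOrder S] [OrderClosedTopology S]
    {μ : ℕ → ProbabilityMeasure S}
    (htight : IsTightMeasureSet (Set.range fun t => (μ t : Measure S)))
    (hcauchy : ∀ ε : ℝ≥0∞, 0 < ε → ∃ T, ∀ t ≥ T, ∀ I : Set S, MeasurableSet I → IsUpperSet I →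
      (μ t : Measure S) I ≤ (μ T : Measure S) I + ε ∧
      (μ T : Measure S) I ≤ (μ t : Measure S) I + ε) :
    ∃ ν : ProbabilityMeasure S, ∀ I : Set S, MeasurableSet I → IsUpperSet I →
      Tendsto (fun t => (μ t : Measure S) I) atTop (𝓝 ((ν : Measure S) I)) := by
  have hcomp : IsCompact (closure (Set.range μ)) := by
    refine isCompact_closure_of_isTightMeasureSet ?_
    convert htight using 1
    ext m
    simp
  -- By Prokhorov the range is relatively compact. The ultrafilter replaces extraction of a
  -- convergent subsequence.
  set L : Ultrafilter ℕ := Ultrafilter.of atTop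
  have hL : (L : Filter ℕ) ≤ atTop := Ultrafilter.of_le _
  obtain ⟨ν, -, hν⟩ := isCompact_iff_ultrafilter_le_nhds.1 hcomp (L.map μ)
    (le_principal_iff.2 (mem_map.2 (univ_mem' fun t => subset_closure (Set.mem_range_self t))))
  have hν' : Tendsto μ L (𝓝 ν) := hν
  have hcompl : ∀ (φ : ProbabilityMeasure S) {I : Set S}, MeasurableSet I →
      (φ : Measure S) Iᶜ = 1 - (φ : Measure S) I := fun φ I hI => prob_compl_eq_one_sub hI
  have hflip : ∀ (φ ψ : ProbabilityMeasure S) {I : Set S} {ε : ℝ≥0∞}, MeasurableSet I →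
      (φ : Measure S) I ≤ (ψ : Measure S) I + ε →
      (ψ : Measure S) Iᶜ ≤ (φ : Measure S) Iᶜ + ε := by
    intro φ ψ I ε hI h
    rw [hcompl ψ hI, hcompl φ hI, tsub_le_iff_right]
    calc (1 : ℝ≥0∞) ≤ (1 - (φ : Measure S) I) + (φ : Measure S) I := le_tsub_add
      _ ≤ (1 - (φ : Measure S) I) + ((ψ : Measure S) I + ε) := by gcongr
      _ = 1 - (φ : Measure S) I + ε + (ψ : Measure S) I := by ring
  refine ⟨ν, fun I hI hIu => ?_⟩
  rw [ENNReal.tendsto_atTop (measure_ne_top _ _)]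
  intro ε hε
  set η : ℝ≥0∞ := ε / 6
  have hη0 : 0 < η := ENNReal.div_pos hε.ne' (by norm_num)
  have h6 : 6 * η ≤ ε := (ENNReal.mul_div_cancel (by norm_num) (by norm_num)).le
  have hlow := eventually_measure_le_of_tendsto_ultrafilter htight hcauchy hL hν' hI hIu hη0
  have hup : ∀ᶠ t in atTop, (ν : Measure S) Iᶜ ≤ (μ t : Measure S) Iᶜ + 6 * η := by
    -- In the reversed order `Iᶜ` is increasing, so the same one-sided estimate yields the upper
    -- bound on `I`.
    let ord : Preorder S := (inferInstance : Preorder Sᵒᵈ)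
    have : @OrderClosedTopology S _ ord := 
      ⟨OrderClosedTopology.isClosed_le'.preimage continuous_swap⟩
    refine @eventually_measure_le_of_tendsto_ultrafilter S _ _ _ _ ord this μ ν htight ?_ L hL hν'
      Iᶜ hI.compl (fun a b hab ha hb => ha (hIu hab hb)) η hη0
    intro ε' hε'
    obtain ⟨T, hT⟩ := hcauchy ε' hε'
    refine ⟨T, fun t ht J hJ hJu => ?_⟩
    have hJc := hT t ht Jᶜ hJ.compl (fun a b hab ha hb => ha (hJu hab hb))
    exact ⟨by simpa using hflip _ _ hJ.compl hJc.2, by simpa using hflip _ _ hJ.compl hJc.1⟩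
  obtain ⟨T, hT⟩ := eventually_atTop.1 (hlow.and hup)
  refine ⟨T, fun t ht => ⟨?_, ?_⟩⟩
  · rw [tsub_le_iff_right]
    exact (hT t ht).1.trans (by gcongr)
  · have := hflip ν (μ t) hI.compl (hT t ht).2
    simp only [compl_compl] at this
    exact this.trans (by gcongr)

end OrderedPolish

/-! ### Iterated kernels -/

section StepKernel

variable {α : Type*} [MeasurableSpace α] (P : Kernel α α)

instance isMarkovKernel_stepKernel [IsMarkovKernel P] (t : ℕ) :
    IsMarkovKernel (stepKernel P t) := by
  induction t with
  | zero => exact inferInstanceAs (IsMarkovKernel Kernel.id)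
  | succ t ih => exact inferInstanceAs (IsMarkovKernel (P ∘ₖ stepKernel P t))

theorem stepKernel_add (s t : ℕ) :
    stepKernel P (s + t) = stepKernel P t ∘ₖ stepKernel P s := by
  induction t with
  | zero => exact (Kernel.id_comp _).symm
  | succ t ih =>
    change P ∘ₖ stepKernel P (s + t) = (P ∘ₖ stepKernel P t) ∘ₖ stepKernel P s
    rw [ih, Kernel.comp_assoc]

theorem stepKernel_one : stepKernel P 1 = P := Kernel.comp_id P

theorem stepKernel_parallelComp [IsMarkovKernel P] (t : ℕ) :
    stepKernel (P ∥ₖ P) t = stepKernel P t ∥ₖ stepKernel P t := by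
  induction t with
  | zero => exact Kernel.id_parallelComp_id.symm
  | succ t ih =>
    change (P ∥ₖ P) ∘ₖ stepKernel (P ∥ₖ P) t = _
    rw [ih, Kernel.parallelComp_comp_parallelComp]
    rfl

theorem lintegral_stepKernel_add (s t : ℕ) {f : α → ℝ≥0∞} (hf : Measurable f) (x : α) :
    ∫⁻ z, f z ∂(stepKernel P (s + t) x) =
      ∫⁻ y, ∫⁻ z, f z ∂(stepKernel P t y) ∂(stepKernel P s x) := by
  rw [stepKernel_add, Kernel.lintegral_comp _ _ _ hf]

end StepKernel

/-! ### Survival probabilities of a killed chain -/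

section KilledChain

variable {α : Type*} [MeasurableSpace α] (Q : Kernel α α) (N : Set α)

/-- One step of the chain with kernel `Q` killed outside of `N`, acting on functions. -/
noncomputable def killedStep (f : α → ℝ≥0∞) : α → ℝ≥0∞ :=
  N.indicator fun p => ∫⁻ z, f z ∂(Q p)

/-- The probability that the chain with kernel `Q` stays in `N` up to time `t`, as a function of
the initial state. -/
noncomputable def survival (t : ℕ) : α → ℝ≥0∞ :=
  (killedStep Q N)^[t] (N.indicator 1)

variable {Q N}

theorem measurable_killedStep (hN : MeasurableSet N) {f : α → ℝ≥0∞} (hf : Measurable f) :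
    Measurable (killedStep Q N f) :=
  hf.lintegral_kernel.indicator hN

theorem measurable_killedStep_iterate (hN : MeasurableSet N) {f : α → ℝ≥0∞} (hf : Measurable f)
    (t : ℕ) : Measurable ((killedStep Q N)^[t] f) := by
  induction t with
  | zero => exact hf
  | succ t ih => rw [Function.iterate_succ_apply']; exact measurable_killedStep hN ih

theorem measurable_survival (hN : MeasurableSet N) (t : ℕ) : Measurable (survival Q N t) :=
  measurable_killedStep_iterate hN (measurable_one.indicator hN) t

theorem killedStep_mono : Monotone (killedStep Q N) := fun f g hfg p => by
  by_cases hp : p ∈ N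
  · simpa [killedStep, hp] using lintegral_mono hfg
  · simp [killedStep, hp]

theorem killedStep_const_mul_add (c d : ℝ≥0∞) {f g : α → ℝ≥0∞} (hf : Measurable f)
    (hg : Measurable g) :
    killedStep Q N (fun p => c * f p + d * g p) =
      fun p => c * killedStep Q N f p + d * killedStep Q N g p := by
  funext p
  by_cases hp : p ∈ N
  · simp only [killedStep, hp, Set.indicator_of_mem]
    rw [lintegral_add_left (hf.const_mul c), lintegral_const_mul c hf, lintegral_const_mul d hg]
  · simp [killedStep, hp]

theorem killedStep_iterate_const_mul_add (hN : MeasurableSet N) (c d : ℝ≥0∞) {f g : α → ℝ≥0∞}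
    (hf : Measurable f) (hg : Measurable g) (t : ℕ) :
    (killedStep Q N)^[t] (fun p => c * f p + d * g p) =
      fun p => c * (killedStep Q N)^[t] f p + d * (killedStep Q N)^[t] g p := by
  induction t with
  | zero => rfl
  | succ t ih =>
    simp only [Function.iterate_succ_apply', ih]
    exact killedStep_const_mul_add c d (measurable_killedStep_iterate hN hf t)
      (measurable_killedStep_iterate hN hg t)

/-- Removing the killing can only increase the integral of a nonnegative function. -/
theorem killedStep_iterate_le (hN : MeasurableSet N) {f : α → ℝ≥0∞} (hf : Measurable f) (t : ℕ)
    (p : α) : (killedStep Q N)^[t] f p ≤ ∫⁻ z, f z ∂(stepKernel Q t p) := by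
  induction t generalizing f with
  | zero =>
    change f p ≤ ∫⁻ z, f z ∂(Kernel.id p)
    rw [Kernel.id_apply, lintegral_dirac' _ hf]
  | succ t ih =>
    rw [Function.iterate_succ_apply, lintegral_stepKernel_add Q t 1 hf, stepKernel_one]
    exact (ih (measurable_killedStep hN hf)).trans
      (lintegral_mono fun z => Set.indicator_le_self _ _ z)

theorem survival_eq_zero {p : α} (hp : p ∉ N) (t : ℕ) : survival Q N t p = 0 := by
  cases t with
  | zero => simp [survival, hp]
  | succ t => simp [survival, Function.iterate_succ_apply', killedStep, hp]

theorem survival_succ {p : α} (hp : p ∈ N) (t : ℕ) :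
    survival Q N (t + 1) p = ∫⁻ z, survival Q N t z ∂(Q p) := by
  simp [survival, Function.iterate_succ_apply', killedStep, hp]

theorem survival_le_one [IsMarkovKernel Q] (t : ℕ) (p : α) : survival Q N t p ≤ 1 := by
  induction t generalizing p with
  | zero => exact Set.indicator_le_self _ _ p
  | succ t ih =>
    by_cases hp : p ∈ N
    · rw [survival_succ hp]
      exact (lintegral_mono ih).trans (by simp)
    · simp [survival_eq_zero hp]

theorem survival_antitone [IsMarkovKernel Q] (p : α) : Antitone fun t => survival Q N t p := by
  refine antitone_nat_of_succ_le fun t => ?_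
  induction t generalizing p with
  | zero =>
    by_cases hp : p ∈ N
    · simpa [survival, hp] using survival_le_one (Q := Q) (N := N) 1 p
    · simp [survival_eq_zero hp]
  | succ t ih =>
    by_cases hp : p ∈ N
    · rw [survival_succ hp, survival_succ hp]
      exact lintegral_mono ih
    · simp [survival_eq_zero hp]

/-- If from every state of `B` the chain leaves `N` by time `n` with probability at least `δ`,
then the survival probability contracts, up to the probability of being outside of `B`. -/
theorem survival_add_le [IsMarkovKernel Q] (hN : MeasurableSet N) {B : Set α}
    (hB : MeasurableSet B) {n : ℕ} {δ : ℝ≥0∞} (hδ : δ ≤ 1)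
    (hleave : ∀ p ∈ B, δ ≤ stepKernel Q n p Nᶜ) (k : ℕ) (p : α) :
    survival Q N (k + n) p ≤ (1 - δ) * survival Q N k p + δ * stepKernel Q k p Bᶜ := by
  -- Inside `N ∩ B` survival for `n` steps has probability at most `1 - δ`; on `N \ B` the two terms
  -- add up to the trivial bound `1`. Applying `k` killed steps then gives the claim.
  have hstep : survival Q N n ≤
      fun z => (1 - δ) * N.indicator 1 z + δ * Bᶜ.indicator 1 z := by
    intro z
    by_cases hz : z ∈ N
    · by_cases hzB : z ∈ B
      · have hle : survival Q N n z ≤ stepKernel Q n z N := by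
          have := killedStep_iterate_le (Q := Q) hN (measurable_one.indicator hN) n z
          rwa [lintegral_indicator_one hN] at this
        have hcompl : stepKernel Q n z N ≤ 1 - δ := by
          rw [← compl_compl N, prob_compl_eq_one_sub hN.compl]
          exact tsub_le_tsub_left (hleave z hzB) 1
        simpa [hz, hzB] using hle.trans hcompl
      · simpa [hz, hzB, tsub_add_cancel_of_le hδ] using survival_le_one (Q := Q) (N := N) n z
    · simp [survival_eq_zero hz]
  calc survival Q N (k + n) p = (killedStep Q N)^[k] (survival Q N n) p := by
        simp only [survival, Function.iterate_add_apply]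
    _ ≤ (killedStep Q N)^[k] (fun z => (1 - δ) * N.indicator 1 z + δ * Bᶜ.indicator 1 z) p :=
        (killedStep_mono.iterate k) hstep p
    _ = (1 - δ) * survival Q N k p + δ * (killedStep Q N)^[k] (Bᶜ.indicator 1) p := by
        rw [killedStep_iterate_const_mul_add hN _ _ (measurable_one.indicator hN)
          (measurable_one.indicator hB.compl)]
        rfl
    _ ≤ (1 - δ) * survival Q N k p + δ * stepKernel Q k p Bᶜ := by
        gcongr
        have := killedStep_iterate_le (Q := Q) hN (measurable_one.indicator hB.compl) k p
        rwa [lintegral_indicator_one hB.compl] at this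

/-- A chain which mostly stays in regions from which leaving `N` has probability bounded below
leaves `N` almost surely. -/
theorem tendsto_survival_zero [IsMarkovKernel Q] (hN : MeasurableSet N) (p : α)
    (h : ∀ ε : ℝ≥0∞, 0 < ε → ∃ B : Set α, MeasurableSet B ∧
      (∀ k, stepKernel Q k p Bᶜ ≤ ε) ∧
      ∃ n : ℕ, ∃ δ : ℝ≥0∞, 0 < δ ∧ ∀ z ∈ B, δ ≤ stepKernel Q n z Nᶜ) :
    Tendsto (fun t => survival Q N t p) atTop (𝓝 0) := by
  have hlim := tendsto_atTop_iInf (survival_antitone (Q := Q) (N := N) p)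
  set s := ⨅ t, survival Q N t p
  have hs1 : s ≤ 1 := (iInf_le _ 0).trans (survival_le_one 0 p)
  have hsfin : s ≠ ∞ := (hs1.trans_lt ENNReal.one_lt_top).ne
  suffices hs : s = 0 by rwa [hs] at hlim
  refine le_antisymm (le_of_forall_gt fun ε hε => ?_) zero_le
  obtain ⟨η, hη0, hηε⟩ := exists_between hε
  obtain ⟨B, hB, hBε, n, δ₀, hδ₀, hleave⟩ := h η hη0
  -- The cap keeps the truncated subtraction `1 - δ` exact even when `B` is empty and `δ₀` is
  -- unconstrained.
  set δ := min δ₀ 1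
  have hδ0 : δ ≠ 0 := (lt_min hδ₀ one_pos).ne'
  have hδ1 : δ ≤ 1 := min_le_right _ _
  have hδtop : δ ≠ ∞ := (hδ1.trans_lt ENNReal.one_lt_top).ne
  -- Passing to the limit in the contraction forces `s ≤ η`.
  have hle : s ≤ (1 - δ) * s + δ * η := by
    have hlim' : Tendsto (fun k => (1 - δ) * survival Q N k p + δ * η) atTop
        (𝓝 ((1 - δ) * s + δ * η)) :=
      (ENNReal.Tendsto.const_mul hlim (Or.inr (ENNReal.sub_ne_top ENNReal.one_ne_top))).add_const _
    refine ge_of_tendsto' hlim' fun k => (iInf_le _ (k + n)).trans ?_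
    refine (survival_add_le hN hB hδ1 (fun z hz => (min_le_left _ _).trans (hleave z hz)) k p).trans
      ?_
    gcongr
    exact hBε k
  have hsplit : s = (1 - δ) * s + δ * s := by
    rw [← add_mul, tsub_add_cancel_of_le hδ1, one_mul]
  have hfin : (1 - δ) * s ≠ ∞ := ENNReal.mul_ne_top (ENNReal.sub_ne_top ENNReal.one_ne_top) hsfin
  have hmul : δ * s ≤ δ * η := by
    refine (ENNReal.add_le_add_iff_left hfin).1 ?_
    rwa [← hsplit]
  exact ((ENNReal.mul_le_mul_iff_right hδ0 hδtop).1 hmul).trans_lt hηε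

end KilledChain

/-! ### Increasing test functions and comparison of two chains -/

section IncreasingFunctions

variable {S : Type u} [MeasurableSpace S] [PartialOrder S]

/-- Increasing measurable functions with values in `[0, 1]`. -/
def UnitInc (S : Type u) [MeasurableSpace S] [PartialOrder S] : Set (S → ℝ≥0∞) :=
  {f | Measurable f ∧ Monotone f ∧ ∀ x, f x ≤ 1}

theorem indicator_mem_unitInc {I : Set S} (hI : MeasurableSet I) (hIu : IsUpperSet I) :
    I.indicator 1 ∈ UnitInc S := by
  refine ⟨measurable_one.indicator hI, fun x y hxy => ?_, Set.indicator_le_self _ _⟩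
  by_cases hx : x ∈ I
  · simp [hx, hIu hxy hx]
  · simp [hx]

theorem lintegral_le_one_of_le_one {S : Type*} [MeasurableSpace S] {μ : Measure S}
    [IsProbabilityMeasure μ] {f : S → ℝ≥0∞}
    (hf : ∀ x, f x ≤ 1) : ∫⁻ x, f x ∂μ ≤ 1 :=
  (lintegral_mono hf).trans (by simp)

theorem StochDom.lintegral_le {φ ψ : ProbabilityMeasure S} (h : StochDom φ ψ) {f : S → ℝ≥0∞}
    (hf : f ∈ UnitInc S) :
    ∫⁻ x, f x ∂(φ : Measure S) ≤ ∫⁻ x, f x ∂(ψ : Measure S) := by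
  obtain ⟨hfm, hmono, h1⟩ := hf
  have hlt : ∀ x, f x < ∞ := fun x => (h1 x).trans_lt ENNReal.one_lt_top
  have hmem : (fun x => (f x).toReal) ∈ IncBddMeas S := by
    refine ⟨hfm.ennreal_toReal, fun x y hxy => ENNReal.toReal_mono (hlt y).ne (hmono hxy), 1,
      fun x => ?_⟩
    rw [abs_of_nonneg ENNReal.toReal_nonneg]
    exact ENNReal.toReal_mono ENNReal.one_ne_top (h1 x)
  have := h _ hmem
  rw [integral_toReal hfm.aemeasurable (Eventually.of_forall hlt),
    integral_toReal hfm.aemeasurable (Eventually.of_forall hlt)] at this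
  refine (ENNReal.toReal_le_toReal ?_ ?_).1 this
  · exact ((lintegral_le_one_of_le_one h1).trans_lt ENNReal.one_lt_top).ne
  · exact ((lintegral_le_one_of_le_one h1).trans_lt ENNReal.one_lt_top).ne

variable {P : Kernel S S} [IsMarkovKernel P]

theorem IncreasingKernel.lintegral_mem (hinc : IncreasingKernel P) {f : S → ℝ≥0∞}
    (hf : f ∈ UnitInc S) : (fun x => ∫⁻ y, f y ∂(P x)) ∈ UnitInc S :=
  ⟨hf.1.lintegral_kernel, fun x x' hx => (hinc x x' hx).lintegral_le hf,
    fun _ => lintegral_le_one_of_le_one hf.2.2⟩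

theorem IncreasingKernel.lintegral_stepKernel_mem (hinc : IncreasingKernel P) (t : ℕ)
    {f : S → ℝ≥0∞} (hf : f ∈ UnitInc S) :
    (fun x => ∫⁻ y, f y ∂(stepKernel P t x)) ∈ UnitInc S := by
  induction t with
  | zero =>
    convert hf using 2 with x
    change ∫⁻ y, f y ∂(Kernel.id x) = f x
    rw [Kernel.id_apply, lintegral_dirac' _ hf.1]
  | succ t ih =>
    convert hinc.lintegral_mem ih using 2 with x
    rw [add_comm, lintegral_stepKernel_add P 1 t hf.1, stepKernel_one]

theorem IncreasingKernel.stepKernel_le_of_isUpperSet (hinc : IncreasingKernel P) (t : ℕ)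
    {I : Set S} (hI : MeasurableSet I) (hIu : IsUpperSet I) {x x' : S} (hx : x ≤ x') :
    stepKernel P t x I ≤ stepKernel P t x' I := by
  simpa [lintegral_indicator_one hI] using
    (hinc.lintegral_stepKernel_mem t (indicator_mem_unitInc hI hIu)).2.1 hx

theorem IncreasingKernel.stepKernel_le_of_isLowerSet (hinc : IncreasingKernel P) (t : ℕ)
    {I : Set S} (hI : MeasurableSet I) (hIl : IsLowerSet I) {x x' : S} (hx : x ≤ x') :
    stepKernel P t x' I ≤ stepKernel P t x I := by
  rw [← compl_compl I, prob_compl_eq_one_sub hI.compl, prob_compl_eq_one_sub hI.compl]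
  exact tsub_le_tsub_left (hinc.stepKernel_le_of_isUpperSet t hI.compl hIl.compl hx) 1

/-- The pairs of states which are not ordered. -/
def notLE (S : Type u) [PartialOrder S] : Set (S × S) := {p | p.1 ≤ p.2}ᶜ

/-- Independent chains coupled from the first time at which they are ordered. -/
theorem IncreasingKernel.lintegral_stepKernel_le_survival (hinc : IncreasingKernel P)
    (hN : MeasurableSet (notLE S)) {f : S → ℝ≥0∞} (hf : f ∈ UnitInc S) (t : ℕ) (x x' : S) :
    ∫⁻ y, f y ∂(stepKernel P t x) ≤
      survival (P ∥ₖ P) (notLE S) t (x, x') + ∫⁻ y, f y ∂(stepKernel P t x') := by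
  induction t generalizing x x' with
  | zero =>
    by_cases hx : x ≤ x'
    · exact ((hinc.lintegral_stepKernel_mem 0 hf).2.1 hx).trans le_add_self
    · have hmem : (x, x') ∈ notLE S := hx
      have h1 : survival (P ∥ₖ P) (notLE S) 0 (x, x') = 1 := by simp [survival, hmem]
      rw [h1]
      exact ((hinc.lintegral_stepKernel_mem 0 hf).2.2 x).trans le_self_add
  | succ t ih =>
    by_cases hx : x ≤ x'
    · exact ((hinc.lintegral_stepKernel_mem (t + 1) hf).2.1 hx).trans le_add_self
    · have hmem : (x, x') ∈ notLE S := hx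
      set g : S → ℝ≥0∞ := fun x => ∫⁻ y, f y ∂(stepKernel P t x)
      have hg : Measurable g := (hinc.lintegral_stepKernel_mem t hf).1
      have hstep : ∀ z, ∫⁻ y, f y ∂(stepKernel P (t + 1) z) = ∫⁻ y, g y ∂(P z) := fun z => by
        rw [add_comm, lintegral_stepKernel_add P 1 t hf.1, stepKernel_one]
      rw [hstep, hstep, survival_succ hmem, Kernel.parallelComp_apply]
      -- Both integrals become integrals over `P x ⊗ P x'`, so the induction hypothesis applies
      -- pointwise to the pair of next states.
      rw [← (measurePreserving_fst (μ := P x) (ν := P x')).lintegral_comp hg,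
        ← (measurePreserving_snd (μ := P x) (ν := P x')).lintegral_comp hg,
        ← lintegral_add_left (measurable_survival hN t)]
      exact lintegral_mono fun p => ih p.1 p.2

end IncreasingFunctions

/-! ### From Markov processes to iterated kernels -/

section MarkovProcess

variable {S : Type u} [MeasurableSpace S] {P : Kernel S S} [IsMarkovKernel P]

/-- Taking expectations in the Markov property removes the conditioning; only one-time marginals are
needed later. -/
theorem IsMarkovProcess.map_succ {Ω : Type u} [MeasurableSpace Ω] {μ : Measure Ω}
    [IsProbabilityMeasure μ] {X : ℕ → Ω → S} (hX : IsMarkovProcess P μ X) (t : ℕ) :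
    μ.map (X (t + 1)) = (μ.map (X t)).bind P := by
  obtain ⟨hmeas, hmarkov⟩ := hX
  refine Measure.ext fun B hB => ?_
  have hle : (⨆ s : Set.Iic t, MeasurableSpace.comap (X s) inferInstance) ≤
      ‹MeasurableSpace Ω› := iSup_le fun s => (hmeas s).comap_le
  have hint := integral_condExp (μ := μ) hle (f := (X (t + 1) ⁻¹' B).indicator fun _ => (1 : ℝ))
  rw [integral_congr_ae (hmarkov t B hB), integral_indicator_const _ (hmeas (t + 1) hB)] at hint
  have hreal : ∫ ω, (P (X t ω)).real B ∂μ = (∫⁻ ω, P (X t ω) B ∂μ).toReal :=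
    integral_toReal ((P.measurable_coe hB).comp (hmeas t)).aemeasurable
      (Eventually.of_forall fun ω => measure_lt_top _ _)
  have hfin : ∫⁻ ω, P (X t ω) B ∂μ ≠ ∞ :=
    ((lintegral_le_one_of_le_one fun ω => prob_le_one).trans_lt ENNReal.one_lt_top).ne
  rw [Measure.map_apply (hmeas _) hB, Measure.bind_apply hB P.aemeasurable,
    lintegral_map (P.measurable_coe hB) (hmeas t)]
  rw [hreal, smul_eq_mul, mul_one] at hint
  exact ((ENNReal.toReal_eq_toReal_iff' hfin (measure_ne_top _ _)).1 hint).symm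

theorem IsMarkovProcess.map_eq_stepKernel {Ω : Type u} [MeasurableSpace Ω] {μ : Measure Ω}
    [IsProbabilityMeasure μ] {X : ℕ → Ω → S} (hX : IsMarkovProcess P μ X) {x : S}
    (h0 : ∀ᵐ ω ∂μ, X 0 ω = x) (t : ℕ) : μ.map (X t) = stepKernel P t x := by
  induction t with
  | zero =>
    have hconst : X 0 =ᵐ[μ] fun _ => x := h0
    rw [Measure.map_congr hconst, Measure.map_const, measure_univ, one_smul]
    exact (Kernel.id_apply x).symm
  | succ t ih =>
    rw [hX.map_succ, ih]
    exact (Kernel.comp_apply P (stepKernel P t) x).symm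

/-- An order reversing kernel brings two ordered independent chains in the opposite order with
positive probability. -/
theorem OrderReversing.exists_pos [PartialOrder S] (hrev : OrderReversing P)
    (hN : MeasurableSet (notLE S)) {x x' : S} (hx : x' ≤ x) :
    ∃ t : ℕ, 0 < stepKernel (P ∥ₖ P) t (x, x') (notLE S)ᶜ := by
  obtain ⟨Ω, _, X, X', Pr, hPr, hpos⟩ := hrev
  obtain ⟨hprob, hX, hX', hind, h0, h0'⟩ := hPr x x'
  obtain ⟨t, ht⟩ := hpos x x' hx
  refine ⟨t, ?_⟩
  have hindt : IndepFun (X t) (X' t) (Pr x x') :=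
    hind.comp (φ := fun f : ℕ → S => f t) (ψ := fun f : ℕ → S => f t) (measurable_pi_apply t)
      (measurable_pi_apply t)
  have hmap := (indepFun_iff_map_prod_eq_prod_map_map (hX.1 t).aemeasurable
    (hX'.1 t).aemeasurable).1 hindt
  rw [hX.map_eq_stepKernel h0, hX'.map_eq_stepKernel h0'] at hmap
  rw [stepKernel_parallelComp, Kernel.parallelComp_apply, ← hmap,
    Measure.map_apply ((hX.1 t).prodMk (hX'.1 t)) hN.compl]
  simpa [notLE] using ht

end MarkovProcess

/-! ### Compact sets and order intervals -/

section OrderBounded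

variable {S : Type u} [TopologicalSpace S] [PartialOrder S]

theorem CompactIffClosedOrderBounded.exists_Icc (hS : CompactIffClosedOrderBounded S) {K : Set S}
    (hK : IsCompact K) : ∃ a b : S, a ≤ b ∧ K ⊆ Set.Icc a b :=
  ((hS K).1 hK).2

theorem CompactIffClosedOrderBounded.isCompact_Icc [OrderClosedTopology S]
    (hS : CompactIffClosedOrderBounded S) {a b : S} (hab : a ≤ b) : IsCompact (Set.Icc a b) :=
  (hS _).2 ⟨isClosed_Icc, a, b, hab, subset_rfl⟩

end OrderBounded

/-! ### Independent copies become ordered -/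

section Mixing

variable {S : Type u} [MeasurableSpace S] [PartialOrder S] {P : Kernel S S} [IsMarkovKernel P]

/-- Lowering the first starting point or raising the second makes ordering likelier, as Fubini shows
one coordinate at a time. Hence `(b, a)` is the worst point of the box, and positivity there is a
uniform lower bound. -/
theorem IncreasingKernel.stepKernel_parallelComp_le [TopologicalSpace S] [ClosedIicTopology S]
    [ClosedIciTopology S] [OpensMeasurableSpace S]
    (hinc : IncreasingKernel P) (hN : MeasurableSet (notLE S)) (t : ℕ) {y y' a b : S}
    (hy : y ≤ b) (hy' : a ≤ y') :
    stepKernel (P ∥ₖ P) t (b, a) (notLE S)ᶜ ≤ stepKernel (P ∥ₖ P) t (y, y') (notLE S)ᶜ := by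
  simp only [stepKernel_parallelComp, Kernel.parallelComp_apply]
  calc ((stepKernel P t b).prod (stepKernel P t a)) (notLE S)ᶜ
      = ∫⁻ z, stepKernel P t a (Set.Ici z) ∂(stepKernel P t b) := by
        rw [Measure.prod_apply hN.compl]
        simp [notLE, Set.Ici]
    _ ≤ ∫⁻ z, stepKernel P t y' (Set.Ici z) ∂(stepKernel P t b) := lintegral_mono fun z =>
        hinc.stepKernel_le_of_isUpperSet t measurableSet_Ici (isUpperSet_Ici z) hy'
    _ = ((stepKernel P t b).prod (stepKernel P t y')) (notLE S)ᶜ := by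
        rw [Measure.prod_apply hN.compl]
        simp [notLE, Set.Ici]
    _ = ∫⁻ z, stepKernel P t b (Set.Iic z) ∂(stepKernel P t y') := by
        rw [Measure.prod_apply_symm hN.compl]
        simp [notLE, Set.Iic]
    _ ≤ ∫⁻ z, stepKernel P t y (Set.Iic z) ∂(stepKernel P t y') := lintegral_mono fun z =>
        hinc.stepKernel_le_of_isLowerSet t measurableSet_Iic (isLowerSet_Iic z) hy
    _ = ((stepKernel P t y).prod (stepKernel P t y')) (notLE S)ᶜ := by
        rw [Measure.prod_apply_symm hN.compl]
        simp [notLE, Set.Iic]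

variable [TopologicalSpace S]

theorem measurableSet_notLE [SecondCountableTopology S] [OrderClosedTopology S] [BorelSpace S] :
    MeasurableSet (notLE S) :=
  OrderClosedTopology.isClosed_le'.measurableSet.compl

/-- Under boundedness in probability, independent copies of an increasing order reversing chain
become ordered almost surely. -/
theorem tendsto_survival_of_boundedInProbability [SecondCountableTopology S]
    [OrderClosedTopology S] [BorelSpace S] (hS : CompactIffClosedOrderBounded S)
    (hinc : IncreasingKernel P) (hrev : OrderReversing P) (hbdd : BoundedInProbability P)
    (p : S × S) : Tendsto (fun t => survival (P ∥ₖ P) (notLE S) t p) atTop (𝓝 0) := by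
  refine tendsto_survival_zero measurableSet_notLE p fun ε hε => ?_
  have hε2 : 0 < ε / 2 := ENNReal.half_pos hε.ne'
  obtain ⟨K₁, hK₁, hm₁⟩ :=
    isTightMeasureSet_iff_exists_isCompact_measure_compl_le.1 (hbdd p.1) _ hε2
  obtain ⟨K₂, hK₂, hm₂⟩ :=
    isTightMeasureSet_iff_exists_isCompact_measure_compl_le.1 (hbdd p.2) _ hε2
  obtain ⟨a, b, hab, hsub⟩ := hS.exists_Icc (hK₁.union hK₂)
  refine ⟨Set.Icc a b ×ˢ Set.Icc a b, measurableSet_Icc.prod measurableSet_Icc, fun k => ?_, ?_⟩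
  · have hcover : (Set.Icc a b ×ˢ Set.Icc a b)ᶜ ⊆ K₁ᶜ ×ˢ Set.univ ∪ Set.univ ×ˢ K₂ᶜ := by
      rintro ⟨z, z'⟩ hz
      by_contra hcon
      simp only [Set.mem_union, Set.mem_prod, Set.mem_univ, Set.mem_compl_iff, and_true,
        true_and, not_or, not_not] at hcon
      exact hz ⟨hsub (Or.inl hcon.1), hsub (Or.inr hcon.2)⟩
    rw [stepKernel_parallelComp, Kernel.parallelComp_apply]
    calc _ ≤ _ := measure_mono hcover
      _ ≤ _ := measure_union_le _ _
      _ ≤ ε / 2 + ε / 2 := by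
        simp only [Measure.prod_prod, measure_univ, mul_one, one_mul]
        exact add_le_add (hm₁ _ (Set.mem_range_self k)) (hm₂ _ (Set.mem_range_self k))
      _ = ε := ENNReal.add_halves ε
  · obtain ⟨n, hn⟩ := hrev.exists_pos measurableSet_notLE hab
    exact ⟨n, _, hn, fun z hz =>
      hinc.stepKernel_parallelComp_le measurableSet_notLE n hz.1.2 hz.2.1⟩

end Mixing

/-! ### The Markov operator and the Bhattacharya metric -/

section MarkovOperator

variable {S : Type u} [MeasurableSpace S] {P : Kernel S S} [IsMarkovKernel P]

theorem markovOp_iterate (φ : ProbabilityMeasure S) (t : ℕ) :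
    (((markovOp P)^[t] φ : ProbabilityMeasure S) : Measure S) =
      (φ : Measure S).bind (stepKernel P t) := by
  induction t with
  | zero => exact Measure.id_comp.symm
  | succ t ih =>
    rw [Function.iterate_succ_apply']
    change (((markovOp P)^[t] φ : ProbabilityMeasure S) : Measure S).bind P = _
    rw [ih]
    exact Measure.comp_assoc

theorem lintegral_markovOp_iterate (φ : ProbabilityMeasure S) (t : ℕ) {f : S → ℝ≥0∞}
    (hf : Measurable f) :
    ∫⁻ x, f x ∂(((markovOp P)^[t] φ : ProbabilityMeasure S) : Measure S) =
      ∫⁻ x, ∫⁻ y, f y ∂(stepKernel P t x) ∂(φ : Measure S) := by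
  rw [markovOp_iterate, Measure.lintegral_bind (stepKernel P t).aemeasurable hf.aemeasurable]

theorem coe_markovOp_iterate_kernelAt_zero (x : S) (t : ℕ) :
    (((markovOp P)^[t] (kernelAt (stepKernel P 0) x) : ProbabilityMeasure S) : Measure S) =
      stepKernel P t x := by
  rw [markovOp_iterate]
  change (Kernel.id x).bind (stepKernel P t) = _
  rw [Kernel.id_apply, Measure.dirac_bind (stepKernel P t).measurable]

variable [PartialOrder S]

theorem IncreasingKernel.lintegral_markovOp_iterate_le (hinc : IncreasingKernel P)
    (hN : MeasurableSet (notLE S)) {f : S → ℝ≥0∞} (hf : f ∈ UnitInc S) (t : ℕ)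
    (φ ψ : ProbabilityMeasure S) :
    ∫⁻ x, f x ∂(((markovOp P)^[t] φ : ProbabilityMeasure S) : Measure S) ≤
      ∫⁻ x, f x ∂(((markovOp P)^[t] ψ : ProbabilityMeasure S) : Measure S) +
        ∫⁻ p, survival (P ∥ₖ P) (notLE S) t p ∂((φ : Measure S).prod (ψ : Measure S)) := by
  have hg : Measurable fun x => ∫⁻ y, f y ∂(stepKernel P t x) := hf.1.lintegral_kernel
  rw [lintegral_markovOp_iterate φ t hf.1, lintegral_markovOp_iterate ψ t hf.1,
    ← (measurePreserving_fst (μ := (φ : Measure S)) (ν := (ψ : Measure S))).lintegral_comp hg,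
    ← (measurePreserving_snd (μ := (φ : Measure S)) (ν := (ψ : Measure S))).lintegral_comp hg,
    add_comm, ← lintegral_add_left (measurable_survival hN t)]
  exact lintegral_mono fun p => hinc.lintegral_stepKernel_le_survival hN hf t p.1 p.2

theorem tendsto_lintegral_survival (hN : MeasurableSet (notLE S))
    (hsurv : ∀ p, Tendsto (fun t => survival (P ∥ₖ P) (notLE S) t p) atTop (𝓝 0))
    (μ : Measure (S × S)) [IsProbabilityMeasure μ] :
    Tendsto (fun t => ∫⁻ p, survival (P ∥ₖ P) (notLE S) t p ∂μ) atTop (𝓝 0) := by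
  have := tendsto_lintegral_of_dominated_convergence (μ := μ) (fun _ => 1)
    (measurable_survival (Q := P ∥ₖ P) hN)
    (fun t => Eventually.of_forall (survival_le_one t)) (by simp)
    (Eventually.of_forall hsurv)
  simpa using this

theorem bhattacharya_nonneg (φ ψ : ProbabilityMeasure S) : 0 ≤ bhattacharya φ ψ :=
  Real.iSup_nonneg fun _ => abs_nonneg _

theorem abs_integral_le_one {S : Type*} [MeasurableSpace S] {μ : Measure S}
    [IsProbabilityMeasure μ] {h : S → ℝ}
    (hh : ∀ x, |h x| ≤ 1) : |∫ x, h x ∂μ| ≤ 1 := by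
  simpa using norm_integral_le_of_norm_le_const (μ := μ) (f := h) (C := 1)
    (Eventually.of_forall hh)

theorem integrable_of_abs_le_one {S : Type*} [MeasurableSpace S] {μ : Measure S}
    [IsProbabilityMeasure μ] {h : S → ℝ}
    (hm : Measurable h) (hh : ∀ x, |h x| ≤ 1) : Integrable h μ :=
  Integrable.of_bound hm.aestronglyMeasurable 1 (Eventually.of_forall hh)

theorem abs_integral_sub_le_bhattacharya (φ ψ : ProbabilityMeasure S) {h : S → ℝ}
    (hh : h ∈ IncBddMeas S) (h1 : ∀ x, |h x| ≤ 1) :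
    |∫ x, h x ∂(φ : Measure S) - ∫ x, h x ∂(ψ : Measure S)| ≤ bhattacharya φ ψ := by
  refine le_ciSup (f := fun h : {h : S → ℝ // h ∈ IncBddMeas S ∧ ∀ x, |h x| ≤ 1} =>
    |∫ x, h.1 x ∂(φ : Measure S) - ∫ x, h.1 x ∂(ψ : Measure S)|) ?_ ⟨h, hh, h1⟩
  refine ⟨2, ?_⟩
  rintro _ ⟨g, rfl⟩
  refine (abs_sub _ _).trans ?_
  linarith [abs_integral_le_one (μ := (φ : Measure S)) g.2.2,
    abs_integral_le_one (μ := (ψ : Measure S)) g.2.2]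

theorem measure_le_add_bhattacharya (φ ψ : ProbabilityMeasure S) {I : Set S}
    (hI : MeasurableSet I) (hIu : IsUpperSet I) :
    (φ : Measure S) I ≤ (ψ : Measure S) I + ENNReal.ofReal (bhattacharya φ ψ) ∧
    (ψ : Measure S) I ≤ (φ : Measure S) I + ENNReal.ofReal (bhattacharya φ ψ) := by
  have h1 : ∀ x, |I.indicator (fun _ => (1 : ℝ)) x| ≤ 1 := fun x => by
    by_cases hx : x ∈ I <;> simp [hx]
  have hmem : I.indicator (fun _ => (1 : ℝ)) ∈ IncBddMeas S := by
    refine ⟨measurable_const.indicator hI, fun x y hxy => ?_, 1, h1⟩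
    by_cases hx : x ∈ I
    · simp [hx, hIu hxy hx]
    · simpa [hx] using Set.indicator_nonneg (fun _ _ => zero_le_one) y
  have habs := abs_le.1 (abs_integral_sub_le_bhattacharya φ ψ hmem h1)
  rw [integral_indicator_const _ hI, integral_indicator_const _ hI] at habs
  simp only [smul_eq_mul, mul_one] at habs
  have key : ∀ μ ν : ProbabilityMeasure S,
      (μ : Measure S).real I ≤ (ν : Measure S).real I + bhattacharya φ ψ →
      (μ : Measure S) I ≤ (ν : Measure S) I + ENNReal.ofReal (bhattacharya φ ψ) := by
    intro μ ν h
    have := ENNReal.ofReal_le_ofReal h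
    rwa [ENNReal.ofReal_add measureReal_nonneg (bhattacharya_nonneg φ ψ), ofReal_measureReal,
      ofReal_measureReal] at this
  exact ⟨key φ ψ (by linarith), key ψ φ (by linarith)⟩

theorem bhattacharya_le_of_forall_unitInc {φ ψ : ProbabilityMeasure S} {r : ℝ} (hr : 0 ≤ r)
    (h : ∀ f ∈ UnitInc S,
      ∫⁻ x, f x ∂(φ : Measure S) ≤ ∫⁻ x, f x ∂(ψ : Measure S) + ENNReal.ofReal r ∧
      ∫⁻ x, f x ∂(ψ : Measure S) ≤ ∫⁻ x, f x ∂(φ : Measure S) + ENNReal.ofReal r) :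
    bhattacharya φ ψ ≤ 2 * r := by
  refine Real.iSup_le (fun g => ?_) (by positivity)
  obtain ⟨g, ⟨hgm, hgmono, -⟩, hg1⟩ := g
  have hnn : ∀ x, 0 ≤ (g x + 1) / 2 := fun x => by linarith [(abs_le.1 (hg1 x)).1]
  -- Rescaling `[-1, 1]` to `[0, 1]` accounts for the factor `2` in the bound.
  set f : S → ℝ≥0∞ := fun x => ENNReal.ofReal ((g x + 1) / 2)
  have hf : f ∈ UnitInc S := by
    refine ⟨((hgm.add_const 1).div_const 2).ennreal_ofReal, fun x y hxy => ?_, fun x => ?_⟩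
    · refine ENNReal.ofReal_le_ofReal ?_
      linarith [hgmono hxy]
    · refine ENNReal.ofReal_le_one.2 ?_
      linarith [(abs_le.1 (hg1 x)).2]
  have hint : ∀ μ : ProbabilityMeasure S, ∫⁻ x, f x ∂(μ : Measure S) =
      ENNReal.ofReal ((∫ x, g x ∂(μ : Measure S) + 1) / 2) := by
    intro μ
    have hgi : Integrable g (μ : Measure S) := integrable_of_abs_le_one hgm hg1
    have hi : Integrable (fun x => (g x + 1) / 2) (μ : Measure S) :=
      (hgi.add (integrable_const 1)).div_const 2
    rw [← ofReal_integral_eq_lintegral_ofReal hi (Eventually.of_forall hnn)]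
    congr 1
    rw [integral_div, integral_add hgi (integrable_const 1)]
    simp
  have hpos : ∀ μ : ProbabilityMeasure S, 0 ≤ (∫ x, g x ∂(μ : Measure S) + 1) / 2 := fun μ => by
    linarith [(abs_le.1 (abs_integral_le_one (μ := (μ : Measure S)) hg1)).1]
  obtain ⟨h1, h2⟩ := h f hf
  rw [hint, hint, ← ENNReal.ofReal_add (hpos _) hr,
    ENNReal.ofReal_le_ofReal_iff (add_nonneg (hpos _) hr)] at h1 h2
  rw [abs_le]
  constructor <;> linarith

theorem tendsto_bhattacharya_of_forall_unitInc {φ ψ : ℕ → ProbabilityMeasure S}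
    {e : ℕ → ℝ≥0∞} (he : Tendsto e atTop (𝓝 0))
    (h : ∀ t, ∀ f ∈ UnitInc S,
      ∫⁻ x, f x ∂(φ t : Measure S) ≤ ∫⁻ x, f x ∂(ψ t : Measure S) + e t ∧
      ∫⁻ x, f x ∂(ψ t : Measure S) ≤ ∫⁻ x, f x ∂(φ t : Measure S) + e t) :
    Tendsto (fun t => bhattacharya (φ t) (ψ t)) atTop (𝓝 0) := by
  have hbound : Tendsto (fun t => 2 * (e t).toReal) atTop (𝓝 0) := by
    have := ((ENNReal.tendsto_toReal ENNReal.zero_ne_top).comp he).const_mul 2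
    simpa using this
  refine squeeze_zero' (Eventually.of_forall fun t => bhattacharya_nonneg _ _) ?_ hbound
  -- Finiteness is needed because `toReal` sends `∞` to `0`.
  filter_upwards [he.eventually_lt_const ENNReal.zero_lt_top] with t ht
  refine bhattacharya_le_of_forall_unitInc ENNReal.toReal_nonneg ?_
  rw [ENNReal.ofReal_toReal ht.ne]
  exact h t

/-- Convergence on increasing measurable sets implies convergence of integrals of increasing
functions. -/
theorem tendsto_lintegral_of_tendsto_measure {μ : ℕ → ProbabilityMeasure S}
    {ν : ProbabilityMeasure S}
    (h : ∀ I : Set S, MeasurableSet I → IsUpperSet I →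
      Tendsto (fun t => (μ t : Measure S) I) atTop (𝓝 ((ν : Measure S) I)))
    {f : S → ℝ≥0∞} (hf : f ∈ UnitInc S) :
    Tendsto (fun t => ∫⁻ x, f x ∂(μ t : Measure S)) atTop
      (𝓝 (∫⁻ x, f x ∂(ν : Measure S))) := by
  have hfin : ∀ x, f x ≠ ∞ := fun x => ((hf.2.2 x).trans_lt ENNReal.one_lt_top).ne
  -- Layer cake: the superlevel sets of `f` are increasing, and those of level above `1` are empty,
  -- so dominated convergence applies.
  have hlayer : ∀ φ : ProbabilityMeasure S, ∫⁻ x, f x ∂(φ : Measure S) =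
      ∫⁻ r in Set.Ioi (0 : ℝ), (φ : Measure S) {x | r ≤ (f x).toReal} := by
    intro φ
    rw [← lintegral_eq_lintegral_meas_le (φ : Measure S)
      (Eventually.of_forall fun x => ENNReal.toReal_nonneg) hf.1.ennreal_toReal.aemeasurable]
    exact lintegral_congr fun x => (ENNReal.ofReal_toReal (hfin x)).symm
  simp only [hlayer]
  refine tendsto_lintegral_of_dominated_convergence ((Set.Iic (1 : ℝ)).indicator 1)
    (fun t => Antitone.measurable fun r r' hr => measure_mono fun x hx => hr.trans hx)
    (fun t => Eventually.of_forall fun r => ?_) ?_ (Eventually.of_forall fun r => ?_)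
  · by_cases hr : r ≤ 1
    · simpa [hr] using prob_le_one (μ := (μ t : Measure S))
    · have hempty : {x | r ≤ (f x).toReal} = ∅ := by
        refine Set.eq_empty_of_forall_notMem fun x hx => hr (hx.trans ?_)
        exact ENNReal.toReal_mono ENNReal.one_ne_top (hf.2.2 x)
      simp [hempty]
  · rw [lintegral_indicator_one measurableSet_Iic,
      Measure.restrict_apply measurableSet_Iic, Set.inter_comm, Set.Ioi_inter_Iic]
    simp
  · exact h _ (measurableSet_le measurable_const hf.1.ennreal_toReal) fun x y hxy hx =>
      hx.trans (ENNReal.toReal_mono (hfin y) (hf.2.1 hxy))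

end MarkovOperator

/-! ### Stationary distribution and the two implications -/

section Stability

variable {S : Type u} [TopologicalSpace S] [PolishSpace S] [MeasurableSpace S] [BorelSpace S]
  [PartialOrder S] [OrderClosedTopology S] {P : Kernel S S} [IsMarkovKernel P]

/-- The marginal distributions of an increasing, order reversing chain bounded in probability are
uniformly Cauchy on increasing functions. -/
theorem cauchy_stepKernel (hS : CompactIffClosedOrderBounded S) (hinc : IncreasingKernel P)
    (hbdd : BoundedInProbability P)
    (hsurv : ∀ p, Tendsto (fun t => survival (P ∥ₖ P) (notLE S) t p) atTop (𝓝 0))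
    (x : S) {ε : ℝ≥0∞} (hε : 0 < ε) :
    ∃ T, ∀ t ≥ T, ∀ f ∈ UnitInc S,
      ∫⁻ y, f y ∂(stepKernel P t x) ≤ ∫⁻ y, f y ∂(stepKernel P T x) + ε ∧
      ∫⁻ y, f y ∂(stepKernel P T x) ≤ ∫⁻ y, f y ∂(stepKernel P t x) + ε := by
  have hε2 : 0 < ε / 2 := ENNReal.half_pos hε.ne'
  obtain ⟨K, hK, hKm⟩ :=
    isTightMeasureSet_iff_exists_isCompact_measure_compl_le.1 (hbdd x) _ hε2
  obtain ⟨a, b, -, hsub⟩ := hS.exists_Icc hK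
  -- The state at time `s` lies in `[a, b]` up to mass `ε / 2`, and there `g a ≤ g y ≤ g b`. So
  -- comparing `x` with the two endpoints at a single time `T` suffices for all `s` and all `f`.
  obtain ⟨T, hTb, hTa⟩ := ((((hsurv (b, x)).eventually_le_const hε2)).and
    ((hsurv (x, a)).eventually_le_const hε2)).exists
  refine ⟨T, fun t ht f hf => ?_⟩
  obtain ⟨s, rfl⟩ := Nat.exists_eq_add_of_le' ht
  set g : S → ℝ≥0∞ := fun y => ∫⁻ z, f z ∂(stepKernel P T y)
  have hg : g ∈ UnitInc S := hinc.lintegral_stepKernel_mem T hf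
  have hKc : MeasurableSet Kᶜ := hK.isClosed.measurableSet.compl
  have hind : ∫⁻ y, Kᶜ.indicator 1 y ∂(stepKernel P s x) ≤ ε / 2 := by
    rw [lintegral_indicator_one hKc]
    exact hKm _ (Set.mem_range_self s)
  rw [lintegral_stepKernel_add P s T hf.1]
  constructor
  · calc ∫⁻ y, g y ∂(stepKernel P s x)
        ≤ ∫⁻ y, ((g x + ε / 2) + Kᶜ.indicator 1 y) ∂(stepKernel P s x) := by
          refine lintegral_mono fun y => ?_
          by_cases hy : y ∈ K
          · have := (hg.2.1 (hsub hy).2).trans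
              (hinc.lintegral_stepKernel_le_survival measurableSet_notLE hf T b x)
            refine (this.trans ?_).trans le_self_add
            rw [add_comm]
            gcongr
          · simpa [hy] using (hg.2.2 y).trans le_add_self
      _ = (g x + ε / 2) + ∫⁻ y, Kᶜ.indicator 1 y ∂(stepKernel P s x) := by
          rw [lintegral_add_left measurable_const]
          simp
      _ ≤ (g x + ε / 2) + ε / 2 := by gcongr
      _ = g x + ε := by rw [add_assoc, ENNReal.add_halves]
  · calc g x = ∫⁻ _, g x ∂(stepKernel P s x) := by simp
      _ ≤ ∫⁻ y, (g y + (ε / 2 + Kᶜ.indicator 1 y)) ∂(stepKernel P s x) := by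
          refine lintegral_mono fun y => ?_
          by_cases hy : y ∈ K
          · have := hinc.lintegral_stepKernel_le_survival measurableSet_notLE hf T x a
            calc g x ≤ ε / 2 + g y := this.trans (add_le_add hTa (hg.2.1 (hsub hy).1))
              _ ≤ _ := by simp [hy, add_comm]
          · simpa [hy, ← add_assoc] using (hg.2.2 x).trans le_add_self
      _ = ∫⁻ y, g y ∂(stepKernel P s x) +
            (ε / 2 + ∫⁻ y, Kᶜ.indicator 1 y ∂(stepKernel P s x)) := by
          rw [lintegral_add_left hg.1, lintegral_add_left measurable_const]
          simp
      _ ≤ ∫⁻ y, g y ∂(stepKernel P s x) + (ε / 2 + ε / 2) := by gcongr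
      _ = ∫⁻ y, g y ∂(stepKernel P s x) + ε := by rw [ENNReal.add_halves]

theorem probabilityMeasure_ext_of_isUpperSet {φ ψ : ProbabilityMeasure S}
    (h : ∀ I : Set S, MeasurableSet I → IsUpperSet I → (φ : Measure S) I = (ψ : Measure S) I) :
    φ = ψ :=
  Subtype.ext (ext_of_isClosed_isUpperSet (μ := (φ : Measure S)) (ν := (ψ : Measure S))
    fun F hF hFu => h F hF.measurableSet hFu)

/-- The limit of `P^t(x, ·)` on increasing sets also gives limits of integrals of increasing
functions. Since `P` maps such functions to such functions, shifting time by one shows that the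
limit is stationary. -/
theorem exists_markovOp_eq (hS : CompactIffClosedOrderBounded S) (hinc : IncreasingKernel P)
    (hbdd : BoundedInProbability P)
    (hsurv : ∀ p, Tendsto (fun t => survival (P ∥ₖ P) (notLE S) t p) atTop (𝓝 0)) (x : S) :
    ∃ ν : ProbabilityMeasure S, markovOp P ν = ν := by
  obtain ⟨ν, hν⟩ := exists_tendsto_of_tight_of_cauchy
    (μ := fun t => kernelAt (stepKernel P t) x) (hbdd x) (fun ε hε => by
      obtain ⟨T, hT⟩ := cauchy_stepKernel hS hinc hbdd hsurv x hε
      refine ⟨T, fun t ht I hI hIu => ?_⟩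
      have := hT t ht _ (indicator_mem_unitInc hI hIu)
      simpa only [lintegral_indicator_one hI] using! this)
  refine ⟨ν, probabilityMeasure_ext_of_isUpperSet fun I hI hIu => ?_⟩
  have hf := indicator_mem_unitInc hI hIu
  have h1 := tendsto_lintegral_of_tendsto_measure hν (hinc.lintegral_mem hf)
  have h2 := (tendsto_lintegral_of_tendsto_measure hν hf).comp (tendsto_add_atTop_nat 1)
  have hshift : ∀ t, ∫⁻ y, I.indicator 1 y ∂(stepKernel P (t + 1) x) =
      ∫⁻ y, ∫⁻ z, I.indicator 1 z ∂(P y) ∂(stepKernel P t x) := fun t => by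
    rw [lintegral_stepKernel_add P t 1 hf.1, stepKernel_one]
  have heq := tendsto_nhds_unique h1 (h2.congr hshift)
  have hop := lintegral_markovOp_iterate (P := P) ν 1 hf.1
  rw [stepKernel_one, Function.iterate_one] at hop
  rw [heq] at hop
  simpa only [lintegral_indicator_one hI] using hop

theorem GloballyStable.boundedInProbability (hS : CompactIffClosedOrderBounded S)
    (hstable : GloballyStable P) : BoundedInProbability P := by
  obtain ⟨φ, -, -, hconv⟩ := hstable
  intro x
  rw [isTightMeasureSet_iff_exists_isCompact_measure_compl_le]
  intro ε hε
  have hε4 : 0 < ε / 4 := ENNReal.div_pos hε.ne' (by norm_num)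
  have hφtight : IsTightMeasureSet {(φ : Measure S)} := isTightMeasureSet_singleton
  obtain ⟨K, hK, hKm⟩ :=
    isTightMeasureSet_iff_exists_isCompact_measure_compl_le.1 hφtight _ hε4
  obtain ⟨a, b, hab, hsub⟩ := hS.exists_Icc hK
  have hφ : (φ : Measure S) (Set.Icc a b)ᶜ ≤ ε / 4 :=
    (measure_mono (Set.compl_subset_compl.2 hsub)).trans (hKm _ rfl)
  have hlim := hconv (kernelAt (stepKernel P 0) x)
  have hlim' : Tendsto (fun t => ENNReal.ofReal
      (bhattacharya ((markovOp P)^[t] (kernelAt (stepKernel P 0) x)) φ)) atTop (𝓝 0) := by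
    simpa using ENNReal.tendsto_ofReal hlim
  obtain ⟨T, hT⟩ := eventually_atTop.1 (hlim'.eventually_le_const hε4)
  have hfew : ∀ t : ℕ, ∃ K : Set S, IsCompact K ∧ stepKernel P t x Kᶜ ≤ ε := fun t => by
    obtain ⟨K, hK, hKm⟩ := isTightMeasureSet_iff_exists_isCompact_measure_compl_le.1
      (isTightMeasureSet_singleton (μ := stepKernel P t x)) _ hε
    exact ⟨K, hK, hKm _ rfl⟩
  choose C hC hCm using hfew
  -- The interval handles all `t ≥ T`; the finitely many earlier laws are each tight.
  refine ⟨Set.Icc a b ∪ ⋃ t ∈ Finset.range T, C t,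
    (hS.isCompact_Icc hab).union ((Finset.range T).isCompact_biUnion fun t _ => hC t), ?_⟩
  rintro _ ⟨t, rfl⟩
  by_cases ht : t < T
  · refine (measure_mono (Set.compl_subset_compl.2 ?_)).trans (hCm t)
    exact (Set.subset_biUnion_of_mem (u := C) (Finset.mem_coe.2 (Finset.mem_range.2 ht))).trans
      Set.subset_union_right
  · have hβ := hT t (not_lt.1 ht)
    have hcompl : ∀ (μ : Measure S) [IsProbabilityMeasure μ] (I : Set S), MeasurableSet I →
        μ I + μ Iᶜ = 1 := fun μ _ I hI => by rw [measure_add_measure_compl hI, measure_univ]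
    have hup := fun (I : Set S) (hI : MeasurableSet I) (hIu : IsUpperSet I) =>
      measure_le_add_bhattacharya ((markovOp P)^[t] (kernelAt (stepKernel P 0) x)) φ hI hIu
    rw [coe_markovOp_iterate_kernelAt_zero] at hup
    have hIic : stepKernel P t x (Set.Iic b)ᶜ ≤ ε / 4 + ε / 4 := by
      refine (hup _ measurableSet_Iic.compl (isLowerSet_Iic b).compl).1.trans ?_
      refine add_le_add ((measure_mono ?_).trans hφ) hβ
      exact Set.compl_subset_compl.2 fun y hy => hy.2
    -- `(Set.Ici a)ᶜ` is decreasing, so the metric is applied to `Set.Ici a` and complements are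
    -- taken.
    have hIci : stepKernel P t x (Set.Ici a)ᶜ ≤ ε / 4 + ε / 4 := by
      have h1 := (hup _ (measurableSet_Ici (a := a)) (isUpperSet_Ici a)).2
      have h2 := hcompl (stepKernel P t x) _ (measurableSet_Ici (a := a))
      have h3 := hcompl (φ : Measure S) _ (measurableSet_Ici (a := a))
      have h4 : (φ : Measure S) (Set.Ici a)ᶜ ≤ ε / 4 := by
        refine (measure_mono ?_).trans hφ
        exact Set.compl_subset_compl.2 fun y hy => hy.1
      refine (ENNReal.add_le_add_iff_left
        (measure_ne_top (stepKernel P t x) (Set.Ici a))).1 ?_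
      rw [h2, ← h3, ← add_assoc, add_right_comm]
      exact add_le_add (h1.trans (by gcongr)) h4
    calc stepKernel P t x (Set.Icc a b ∪ ⋃ t ∈ Finset.range T, C t)ᶜ
        ≤ stepKernel P t x ((Set.Ici a)ᶜ ∪ (Set.Iic b)ᶜ) := by
          refine measure_mono ?_
          rw [← Set.compl_inter, Set.Ici_inter_Iic]
          exact Set.compl_subset_compl.2 Set.subset_union_left
      _ ≤ stepKernel P t x (Set.Ici a)ᶜ + stepKernel P t x (Set.Iic b)ᶜ := measure_union_le _ _
      _ ≤ (ε / 4 + ε / 4) + (ε / 4 + ε / 4) := add_le_add hIci hIic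
      _ = 4 * (ε / 4) := by ring
      _ = ε := ENNReal.mul_div_cancel (by norm_num) (by norm_num)

theorem BoundedInProbability.globallyStable (hS : CompactIffClosedOrderBounded S)
    (hinc : IncreasingKernel P) (hrev : OrderReversing P) (hbdd : BoundedInProbability P) :
    GloballyStable P := by
  have hsurv := tendsto_survival_of_boundedInProbability hS hinc hrev hbdd
  -- Nonemptiness of `S` follows from the order boundedness of the compact set `∅`.
  obtain ⟨x, -⟩ := hS.exists_Icc isCompact_empty
  obtain ⟨ν, hν⟩ := exists_markovOp_eq hS hinc hbdd hsurv x
  have hstat : ∀ t : ℕ, (markovOp P)^[t] ν = ν := fun t => Function.iterate_fixed hν t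
  have hmix := fun φ ψ : ProbabilityMeasure S =>
    tendsto_lintegral_survival (P := P) measurableSet_notLE hsurv
      ((φ : Measure S).prod (ψ : Measure S))
  refine ⟨ν, hstat, fun ψ hψ => ?_, fun φ => ?_⟩
  · have key : ∀ φ φ' : ProbabilityMeasure S, (∀ t : ℕ, (markovOp P)^[t] φ = φ) →
        (∀ t : ℕ, (markovOp P)^[t] φ' = φ') → ∀ I : Set S, MeasurableSet I → IsUpperSet I →
        (φ : Measure S) I ≤ (φ' : Measure S) I := by
      intro φ φ' hφ hφ' I hI hIu
      have hlim := (hmix φ φ').const_add ((φ' : Measure S) I)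
      rw [add_zero] at hlim
      refine ge_of_tendsto' hlim fun t => ?_
      have := hinc.lintegral_markovOp_iterate_le measurableSet_notLE
        (indicator_mem_unitInc hI hIu) t φ φ'
      rwa [hφ, hφ', lintegral_indicator_one hI, lintegral_indicator_one hI] at this
    exact probabilityMeasure_ext_of_isUpperSet fun I hI hIu =>
      le_antisymm (key ψ ν hψ hstat I hI hIu) (key ν ψ hstat hψ I hI hIu)
  · have he := (hmix φ ν).add (hmix ν φ)
    rw [add_zero] at he
    refine tendsto_bhattacharya_of_forall_unitInc (ψ := fun _ => ν) he fun t f hf => ?_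
    have h1 := hinc.lintegral_markovOp_iterate_le measurableSet_notLE hf t φ ν
    have h2 := hinc.lintegral_markovOp_iterate_le measurableSet_notLE hf t ν φ
    rw [hstat] at h1 h2
    exact ⟨h1.trans (add_le_add_right le_self_add _), h2.trans (add_le_add_right le_add_self _)⟩

end Stability

end MonotoneMarkov

theorem theorem6p1 {S : Type u} [TopologicalSpace S] [PolishSpace S] [MeasurableSpace S]
    [BorelSpace S] [PartialOrder S] [OrderClosedTopology S]
    (hS : MonotoneMarkov.CompactIffClosedOrderBounded S)
    (P : Kernel S S) [IsMarkovKernel P]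
    (hinc : MonotoneMarkov.IncreasingKernel P)
    (hrev : MonotoneMarkov.OrderReversing P) :
    MonotoneMarkov.GloballyStable P ↔ MonotoneMarkov.BoundedInProbability P := by
  exact ⟨fun h => h.boundedInProbability hS, fun h => h.globallyStable hS hinc hrev⟩
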